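/- Consider equations $\mathcal P_f$: $v_t+v_x^2+f(t,x)v_{xx}=0$ for an unknown function $v=v(t,x)$, where the real coefficient $f$ is smooth and nowhere zero on a region (nonempty connected open set) $D\subset\mathbb R^2$ of the $(t,x)$-plane. Divide this class into three subclasses: $\mathcal P^1$, where $f_{xxx}\not\equiv 0$ on $D$; $\mathcal P^2$, where $f_{xxx}\equiv 0$ on $D$ and $f$ is not constant on $D$; $\mathcal P^3$, where $f$ is constant on $D$. A point transformation from $\mathcal P_f$ (over $D$) to $\mathcal P_{\tilde f}$ (over $\tilde D$) is a smooth diffeomorphism $\Phi=(T,X,V)\colon U\to\tilde U$, $(t,x,v)\mapsto(\tilde t,\tilde x,\tilde v)$, between connected nonempty open subsets of $\mathbb R^3$, in which $T$, $X$, $V$ may a priori depend on all of $t,x,v$, such that $U$ and $\tilde U$ project onto $D$ and $\tilde D$, respectively, and, wherever the second prolongation of $\Phi$ is defined, a $2$-jet over $U$ satisfies $\mathcal P_f$ if and only if its image satisfies $\mathcal P_{\tilde f}$. (a) For every point transformation $\Phi$ from $\mathcal P_f$ to $\mathcal P_{\tilde f}$, locally near each point of $U$ one has $T=T(t)$ and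 $X=X^1(t)x+X^0(t)$, and there is a constant $c_0\ne0$ such that $\tilde f(T,X)=c_0f(t,x)$ on all of $U$. (b) There is no point transformation from an equation of one of the subclasses $\mathcal P^1$, $\mathcal P^2$, $\mathcal P^3$ to an equation of a different one of these subclasses. -/

import Mathlib

open Set Filter Topology
open scoped ContDiff

namespace GPBurgers

/-- Partial derivative in `t` of a function of `(t, x)`. -/
noncomputable def partialT (v : ℝ × ℝ → ℝ) (p : ℝ × ℝ) : ℝ :=
  deriv (fun s => v (s, p.2)) p.1

/-- `n`-th partial derivative in `x` of a function of `(t, x)`. -/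
noncomputable def partialX (n : ℕ) (v : ℝ × ℝ → ℝ) (p : ℝ × ℝ) : ℝ :=
  iteratedDeriv n (fun y => v (p.1, y)) p.2

/-- A generalized potential Burgers equation `v_t + v_x ^ 2 + f(t, x) v_xx = 0`, given by a smooth
nowhere vanishing coefficient `f` on a region (nonempty connected open set) of the `(t, x)`-plane. -/
structure Equation where
  region : Set (ℝ × ℝ)
  f : ℝ × ℝ → ℝ
  isOpen_region : IsOpen region
  isConnected_region : IsConnected region
  smooth_f : ContDiffOn ℝ ∞ f region
  f_ne_zero : ∀ p ∈ region, f p ≠ 0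

/-- The relation `v_t + v_x ^ 2 + f v_xx = 0` at the single point `p`: the 2-jet of `v` at `p`
lies in the manifold which the equation defines in the second-order jet space. -/
def Equation.HoldsAt (E : Equation) (v : ℝ × ℝ → ℝ) (p : ℝ × ℝ) : Prop :=
  partialT v p + partialX 1 v p ^ 2 + E.f p * partialX 2 v p = 0

/-- Equations with `f_xxx ≠ 0` (that is, `f_xxx` is not identically zero on the region). -/
def P1 : Set Equation :=
  {E | ∃ p ∈ E.region, partialX 3 E.f p ≠ 0}

/-- Equations with `f_xxx = 0` and `f` not constant. -/
def P2 : Set Equation :=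
  {E | (∀ p ∈ E.region, partialX 3 E.f p = 0) ∧ ¬ ∃ c : ℝ, ∀ p ∈ E.region, E.f p = c}

/-- Equations with `f` constant. -/
def P3 : Set Equation :=
  {E | ∃ c : ℝ, ∀ p ∈ E.region, E.f p = c}

/-- The projection of `(t, x, v)` to `(t, x)`. -/
def base (z : ℝ × ℝ × ℝ) : ℝ × ℝ := (z.1, z.2.1)

/-- The point `(t, x, v(t, x))` of the graph of `v` over `p = (t, x)`. -/
def graphPt (v : ℝ × ℝ → ℝ) (p : ℝ × ℝ) : ℝ × ℝ × ℝ := (p.1, p.2, v p)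

/-- `Φ = (T, X, V)` carries the graph of `v` near `p` into the graph of `w`:
`w(T, X) = V` at the points `(t, x, v(t, x))` with `(t, x)` near `p`. -/
def CarriesGraph (Φ : ℝ × ℝ × ℝ → ℝ × ℝ × ℝ) (v w : ℝ × ℝ → ℝ) (p : ℝ × ℝ) : Prop :=
  ∀ᶠ q in 𝓝 p, Φ (graphPt v q) = graphPt w (base (Φ (graphPt v q)))

/-- `Φ : (t, x, v) ↦ (T, X, V)` is a point transformation from the equation `E` to the equation
`E'`: a smooth diffeomorphism between regions of the `(t, x, v)`-space lying exactly over the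
regions of the two equations, whose second prolongation maps the manifold of `E` in the jet space to
that of `E'`. The prolongation is spelled out through representatives: if `Φ` carries the graph of
`v` near `p` into the graph of `w`, the 2-jet of `v` at `p` is carried to that of `w` at the image
point. (For jets at which the prolongation is undefined there is no such `w`.) -/
structure IsPointTransformation (E E' : Equation)
    (Φ : OpenPartialHomeomorph (ℝ × ℝ × ℝ) (ℝ × ℝ × ℝ)) : Prop where
  isConnected_source : IsConnected Φ.source
  smooth : ContDiffOn ℝ ∞ Φ Φ.source
  smooth_symm : ContDiffOn ℝ ∞ Φ.symm Φ.target
  base_source : base '' Φ.source = E.region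
  base_target : base '' Φ.target = E'.region
  maps_equation : ∀ (p : ℝ × ℝ) (v w : ℝ × ℝ → ℝ),
    graphPt v p ∈ Φ.source →
    ContDiffAt ℝ 2 v p →
    ContDiffAt ℝ 2 w (base (Φ (graphPt v p))) →
    CarriesGraph Φ v w p →
    (E.HoldsAt v p ↔ E'.HoldsAt w (base (Φ (graphPt v p))))

end GPBurgers

/-!
A point transformation `Φ = (T, X, V)` is analysed through its second prolongation. For a point of
the source and a 2-jet of `v` there at which the Jacobian `J = D_t T D_x X - D_x T D_t X` does not
vanish, the quadratic polynomial with this jet is carried by `Φ` to a smooth function `w` (inverse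
function theorem), and the chain rule expresses `w_t`, `w_x`, `w_xx` at the image point
(`IsPointTransformation.exists_jet`).

The equation for `v` does not contain `v_tt`, whose coefficient in `w_xx` is a nonzero multiple of
`(D_x T)²`; hence `T = T(t)`. The coefficient of `v_xx` then gives `f' T_t = f (D_x X)²`
for all values of `v_x`, hence `X = X(t, x)`. What remains is a quadratic polynomial in `v_x` whose
coefficients vanish (`IsPointTransformation.determining_equation`). With `μ = T_t / X_x²` and
`N = (X_t + f X_xx) / X_x` these coefficients are
`f V_vv = V_v - μ V_v²`, `2 μ V_x V_v + 2 f V_xv = N V_v` and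
`V_t - N V_x + μ V_x² + f V_xx = 0`. For constant `f` they have solutions which are not affine in
`v` (they come from the linearization of the Burgers equation), so `V_v` cannot be expected to be
`1 / μ`. Their differential consequences nevertheless force `μ_t = μ_x = 0`
(`dirDeriv_eq_zero_of_determining_equations`). So `μ` is constant on the connected source,
`X_xx = 0`, and `f' = f / μ` along `Φ`.

Consequently `f` is constant if and only if `f'` is, and three differentiations in `x` of
`f'(T, X¹ x + X⁰) = f / μ` show that `f_xxx` and `f'_xxx` vanish at corresponding points. So each
of the three subclasses is preserved.
-/

namespace GPBurgers

theorem two_le_infty : (2 : WithTop ℕ∞) ≤ ∞ := ENat.LEInfty.out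

/-! ### Directional derivatives of smooth functions -/

section DirectionalDerivative

variable {E : Type*} [NormedAddCommGroup E] [NormedSpace ℝ E]

/-- The directional derivative `∂_u F`, as a function of the point. -/
noncomputable def dirDeriv (u : E) (F : E → ℝ) (z : E) : ℝ := fderiv ℝ F z u

theorem dirDeriv_congr {U : Set E} (hU : IsOpen U) {F G : E → ℝ} (h : ∀ z ∈ U, F z = G z)
    {z : E} (hz : z ∈ U) (u : E) : dirDeriv u F z = dirDeriv u G z := by
  have : F =ᶠ[𝓝 z] G := by
    filter_upwards [hU.mem_nhds hz] with y hy using h y hy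
  simp only [dirDeriv, this.fderiv_eq]

theorem dirDeriv_const (u : E) (c : ℝ) (z : E) : dirDeriv u (fun _ => c) z = 0 := by
  simp [dirDeriv]

theorem dirDeriv_add {F G : E → ℝ} {z : E} (hF : DifferentiableAt ℝ F z)
    (hG : DifferentiableAt ℝ G z) (u : E) :
    dirDeriv u (fun y => F y + G y) z = dirDeriv u F z + dirDeriv u G z := by
  simp [dirDeriv, fderiv_fun_add hF hG]

theorem dirDeriv_sub {F G : E → ℝ} {z : E} (hF : DifferentiableAt ℝ F z)
    (hG : DifferentiableAt ℝ G z) (u : E) :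
    dirDeriv u (fun y => F y - G y) z = dirDeriv u F z - dirDeriv u G z := by
  simp [dirDeriv, fderiv_fun_sub hF hG]

theorem dirDeriv_mul {F G : E → ℝ} {z : E} (hF : DifferentiableAt ℝ F z)
    (hG : DifferentiableAt ℝ G z) (u : E) :
    dirDeriv u (fun y => F y * G y) z = dirDeriv u F z * G z + F z * dirDeriv u G z := by
  simp [dirDeriv, fderiv_fun_mul hF hG]; ring

theorem contDiffOn_dirDeriv {U : Set E} (hU : IsOpen U) {F : E → ℝ} (hF : ContDiffOn ℝ ∞ F U)
    (u : E) : ContDiffOn ℝ ∞ (dirDeriv u F) U :=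
  (hF.fderiv_of_isOpen hU (by simp)).clm_apply contDiffOn_const

theorem differentiableAt_of_mem {U : Set E} (hU : IsOpen U) {F : E → ℝ}
    (hF : ContDiffOn ℝ ∞ F U) {z : E} (hz : z ∈ U) : DifferentiableAt ℝ F z :=
  (hF.contDiffAt (hU.mem_nhds hz)).differentiableAt (by simp)

theorem dirDeriv_dirDeriv {U : Set E} (hU : IsOpen U) {F : E → ℝ} (hF : ContDiffOn ℝ ∞ F U)
    {z : E} (hz : z ∈ U) (u u' : E) :
    dirDeriv u (dirDeriv u' F) z = fderiv ℝ (fderiv ℝ F) z u u' := by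
  have h : DifferentiableAt ℝ (fderiv ℝ F) z :=
    ((hF.fderiv_of_isOpen hU (m := ∞) (by simp)).contDiffAt (hU.mem_nhds hz)).differentiableAt
      (by simp)
  have := (h.hasFDerivAt.clm_apply (hasFDerivAt_const u' z)).fderiv
  change fderiv ℝ (fun y => fderiv ℝ F y u') z u = _
  rw [this]; simp

theorem dirDeriv_comm {U : Set E} (hU : IsOpen U) {F : E → ℝ} (hF : ContDiffOn ℝ ∞ F U)
    {z : E} (hz : z ∈ U) (u u' : E) :
    dirDeriv u (dirDeriv u' F) z = dirDeriv u' (dirDeriv u F) z := by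
  rw [dirDeriv_dirDeriv hU hF hz, dirDeriv_dirDeriv hU hF hz]
  exact ((hF.contDiffAt (hU.mem_nhds hz)).isSymmSndFDerivAt
    (by rw [minSmoothness_of_isRCLikeNormedField]; exact two_le_infty)).eq u u'

end DirectionalDerivative

/-! ### Differential consequences of the determining equations -/

section Rigidity

variable {E : Type*} [NormedAddCommGroup E] [NormedSpace ℝ E]

/-- The determining equations `h₂`, `h₁`, `h₀` (the coefficients of `v_x ^ 2`, `v_x` and `1`) force
`μ_t = μ_x = 0`. In terms of `R = 1 / V_v` they read `F R_v = μ - R`,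
`2 μ V_x R - 2 F R_x = N R`, and, after a differentiation in `v`, `R_t + F R_xx = 0`. Their
compatibility conditions are `F_x R_v = μ_x` and `F_t R_v = μ_t`, and `F R_vv = -R_v` makes both
sides of each vanish. -/
theorem dirDeriv_eq_zero_of_determining_equations {U : Set E} (hU : IsOpen U) {et ex ev : E}
    {F μ N V : E → ℝ}
    (hF : ContDiffOn ℝ ∞ F U) (hμ : ContDiffOn ℝ ∞ μ U) (hN : ContDiffOn ℝ ∞ N U)
    (hV : ContDiffOn ℝ ∞ V U)
    (hV0 : ∀ z ∈ U, dirDeriv ev V z ≠ 0)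
    (hFv : ∀ z ∈ U, dirDeriv ev F z = 0) (hμv : ∀ z ∈ U, dirDeriv ev μ z = 0)
    (hNv : ∀ z ∈ U, dirDeriv ev N z = 0)
    (h₂ : ∀ z ∈ U, F z * dirDeriv ev (dirDeriv ev V) z
      = dirDeriv ev V z - μ z * dirDeriv ev V z ^ 2)
    (h₁ : ∀ z ∈ U, 2 * μ z * dirDeriv ex V z * dirDeriv ev V z
      + 2 * F z * dirDeriv ex (dirDeriv ev V) z = N z * dirDeriv ev V z)
    (h₀ : ∀ z ∈ U, dirDeriv et V z - N z * dirDeriv ex V z + μ z * dirDeriv ex V z ^ 2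
      + F z * dirDeriv ex (dirDeriv ex V) z = 0)
    {z : E} (hz : z ∈ U) : dirDeriv et μ z = 0 ∧ dirDeriv ex μ z = 0 := by
  obtain ⟨R, hRdef⟩ : ∃ R : E → ℝ, R = fun y => (dirDeriv ev V y)⁻¹ := ⟨_, rfl⟩
  have hW : ContDiffOn ℝ ∞ (dirDeriv ev V) U := contDiffOn_dirDeriv hU hV ev
  have hR : ContDiffOn ℝ ∞ R U := hRdef ▸ hW.inv hV0
  have D : ∀ {G : E → ℝ} (u : E), ContDiffOn ℝ ∞ G U → ContDiffOn ℝ ∞ (dirDeriv u G) U :=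
    fun u h => contDiffOn_dirDeriv hU h u
  have hWR : ∀ z ∈ U, dirDeriv ev V z * R z = 1 := fun z hz => by
    rw [hRdef]; exact mul_inv_cancel₀ (hV0 z hz)
  have hR0 : ∀ z ∈ U, R z ≠ 0 := fun z hz h => by simpa [h] using hWR z hz
  have d : ∀ {G : E → ℝ} {y : E}, y ∈ U → ContDiffOn ℝ ∞ G U → DifferentiableAt ℝ G y :=
    fun hy h => differentiableAt_of_mem hU h hy
  -- the first derivatives of `R = 1 / V_v`
  have hWRu : ∀ u, ∀ z ∈ U, dirDeriv u (dirDeriv ev V) z * R z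
      + dirDeriv ev V z * dirDeriv u R z = 0 := fun u z hz => by
    have := dirDeriv_congr hU hWR hz u
    rwa [dirDeriv_const, dirDeriv_mul (d hz hW) (d hz hR)] at this
  have hA : ∀ z ∈ U, F z * dirDeriv ev R z = μ z - R z := fun z hz => by
    have a := h₂ z hz
    have b := hWRu ev z hz
    have c := hWR z hz
    linear_combination R z ^ 2 * (-a) + F z * R z * b
      + (-F z * dirDeriv ev R z - R z + μ z * (dirDeriv ev V z * R z + 1)) * c
  have hB : ∀ z ∈ U, 2 * μ z * dirDeriv ex V z * R z - 2 * F z * dirDeriv ex R z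
      = N z * R z := fun z hz => by
    have a := h₁ z hz
    have b := hWRu ex z hz
    have c := hWR z hz
    linear_combination R z ^ 2 * a - 2 * F z * R z * b
      + (2 * F z * dirDeriv ex R z - 2 * μ z * dirDeriv ex V z * R z + N z * R z) * c
  have hAu : ∀ u, ∀ z ∈ U, dirDeriv u F z * dirDeriv ev R z + F z * dirDeriv u (dirDeriv ev R) z
      = dirDeriv u μ z - dirDeriv u R z := fun u z hz => by
    have := dirDeriv_congr hU hA hz u
    rwa [dirDeriv_mul (d hz hF) (d hz (D ev hR)), dirDeriv_sub (d hz hμ) (d hz hR)] at this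
  have hAv : ∀ z ∈ U, F z * dirDeriv ev (dirDeriv ev R) z = - dirDeriv ev R z := fun z hz => by
    have a := hAu ev z hz
    rw [hFv z hz, hμv z hz] at a
    linarith
  -- If `F_u R_v = μ_u` on `U`, then differentiating in `v` yields `F_u R_vv = 0`, where
  -- `F R_vv = -R_v`; so both sides vanish.
  have key : ∀ u, (∀ z ∈ U, dirDeriv u F z * dirDeriv ev R z = dirDeriv u μ z) →
      ∀ z ∈ U, dirDeriv u F z * dirDeriv ev R z = 0 ∧ dirDeriv u μ z = 0 := fun u h z hz => by
    have a := dirDeriv_congr hU h hz ev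
    rw [dirDeriv_mul (d hz (D u hF)) (d hz (D ev hR)), dirDeriv_comm hU hF hz,
      dirDeriv_comm hU hμ hz, dirDeriv_congr hU hFv hz, dirDeriv_congr hU hμv hz,
      dirDeriv_const] at a
    have b := hAv z hz
    have c : dirDeriv u F z * dirDeriv ev R z = 0 := by
      linear_combination -F z * a + dirDeriv u F z * b
    exact ⟨c, by rw [← h z hz, c]⟩
  have hVxv : ∀ z ∈ U, dirDeriv ev (dirDeriv ex V) z * R z
      + dirDeriv ev V z * dirDeriv ex R z = 0 := fun z hz => by
    rw [dirDeriv_comm hU hV hz]; exact hWRu ex z hz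
  have hX := key ex fun z hz => by
    have a := dirDeriv_congr hU hB hz ev
    rw [dirDeriv_sub (d hz (by fun_prop)) (d hz (by fun_prop)),
      dirDeriv_mul (d hz (by fun_prop)) (d hz hR),
      dirDeriv_mul (d hz (by fun_prop)) (d hz (D ex hV)),
      dirDeriv_mul (d hz (by fun_prop)) (d hz hμ),
      dirDeriv_mul (d hz (by fun_prop)) (d hz (D ex hR)),
      dirDeriv_mul (d hz (by fun_prop)) (d hz hF),
      dirDeriv_mul (d hz hN) (d hz hR), dirDeriv_const, hμv z hz, hFv z hz, hNv z hz,
      dirDeriv_comm hU hR hz] at a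
    have b := hVxv z hz
    have e := hB z hz
    have c := hWR z hz
    have f := hAu ex z hz
    have g := hA z hz
    apply mul_left_cancel₀ (hR0 z hz)
    linear_combination R z * f + (1 / 2) * (R z * a - dirDeriv ev R z * e - 2 * μ z * R z * b
      + 2 * μ z * dirDeriv ex R z * c - 2 * dirDeriv ex R z * g)
  have hC : ∀ z ∈ U, dirDeriv et R z + F z * dirDeriv ex (dirDeriv ex R) z = 0 := fun z hz => by
    have a := dirDeriv_congr hU h₀ hz ev
    simp only [pow_two] at a
    rw [dirDeriv_add (d hz (by fun_prop)) (d hz (by fun_prop)),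
      dirDeriv_add (d hz (by fun_prop)) (d hz (by fun_prop)),
      dirDeriv_sub (d hz (by fun_prop)) (d hz (by fun_prop)),
      dirDeriv_mul (d hz hN) (d hz (D ex hV)),
      dirDeriv_mul (d hz hμ) (d hz (by fun_prop)),
      dirDeriv_mul (d hz (D ex hV)) (d hz (D ex hV)),
      dirDeriv_mul (d hz hF) (d hz (D ex (D ex hV))), dirDeriv_const, hμv z hz, hFv z hz, hNv z hz,
      dirDeriv_comm hU (D ex hV) hz, dirDeriv_comm hU hV hz ev et, dirDeriv_comm hU hV hz ev ex,
      dirDeriv_congr hU (fun y hy => dirDeriv_comm hU hV hy ev ex) hz ex] at a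
    have k := dirDeriv_congr hU (hWRu ex) hz ex
    rw [dirDeriv_add (d hz (by fun_prop)) (d hz (by fun_prop)),
      dirDeriv_mul (d hz (D ex hW)) (d hz hR), dirDeriv_mul (d hz hW) (d hz (D ex hR)),
      dirDeriv_const] at k
    have b := hWRu et z hz
    have e := hB z hz
    have c := hWR z hz
    linear_combination -R z ^ 2 * a + R z * b + R z * dirDeriv ex (dirDeriv ev V) z * e
      + F z * R z * k - (dirDeriv et R z + F z * dirDeriv ex (dirDeriv ex R) z) * c
  have hAx : ∀ z ∈ U, F z * dirDeriv ex (dirDeriv ev R) z = - 1 * dirDeriv ex R z := fun z hz => by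
    have a := hAu ex z hz
    have b := hX z hz
    linear_combination a - b.1 + b.2
  have hT := key et fun z hz => by
    have a := dirDeriv_congr hU hC hz ev
    rw [dirDeriv_add (d hz (by fun_prop)) (d hz (by fun_prop)),
      dirDeriv_mul (d hz hF) (d hz (D ex (D ex hR))), dirDeriv_const, hFv z hz,
      dirDeriv_comm hU (D ex hR) hz, dirDeriv_comm hU hR hz ev et,
      dirDeriv_congr hU (fun y hy => dirDeriv_comm hU hR hy ev ex) hz ex] at a
    have b := dirDeriv_congr hU hAx hz ex
    rw [dirDeriv_mul (d hz hF) (d hz (D ex (D ev hR))),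
      dirDeriv_mul (d hz (by fun_prop)) (d hz (D ex hR)), dirDeriv_const] at b
    have c := dirDeriv_congr hU (fun y hy => (hX y hy).1) hz ex
    rw [dirDeriv_mul (d hz (D ex hF)) (d hz (D ev hR)), dirDeriv_const] at c
    -- `F_x R_v = 0` gives `F_x² R_vx = 0`, hence `F_x R_vx = 0`.
    have e : dirDeriv ex F z * dirDeriv ex (dirDeriv ev R) z = 0 := by
      by_cases h : dirDeriv ex F z = 0
      · rw [h, zero_mul]
      · apply mul_left_cancel₀ h
        linear_combination dirDeriv ex F z * c - dirDeriv ex (dirDeriv ex F) z * (hX z hz).1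
    have f := hAu et z hz
    have g := hC z hz
    linear_combination f - F z * a + F z * b - F z * e - g
  exact ⟨(hT z hz).2, (hX z hz).2⟩

end Rigidity
/-! ### Second derivatives along curves, and polynomials with a given 2-jet -/

section Curves

variable {E : Type*} [NormedAddCommGroup E] [NormedSpace ℝ E]

/-- The first and second derivatives of a function `F` of class `C²` along a curve `γ`. -/
theorem hasDerivAt_comp_curve {F : E → ℝ} {γ γ' : ℝ → E} {γ'' : E} {s₀ : ℝ}
    (hF : ContDiffAt ℝ 2 F (γ s₀)) (hγ : ∀ᶠ s in 𝓝 s₀, HasDerivAt γ (γ' s) s)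
    (hγ' : HasDerivAt γ' γ'' s₀) :
    (∀ᶠ s in 𝓝 s₀, HasDerivAt (fun s => F (γ s)) (fderiv ℝ F (γ s) (γ' s)) s) ∧
      HasDerivAt (fun s => fderiv ℝ F (γ s) (γ' s))
        (fderiv ℝ (fderiv ℝ F) (γ s₀) (γ' s₀) (γ' s₀) + fderiv ℝ F (γ s₀) γ'') s₀ := by
  have h0 : HasDerivAt γ (γ' s₀) s₀ := hγ.self_of_nhds
  constructor
  · have hd : ∀ᶠ y in 𝓝 (γ s₀), DifferentiableAt ℝ F y :=
      (hF.eventually (by simp)).mono fun y hy => hy.differentiableAt (by simp)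
    filter_upwards [hγ, h0.continuousAt.eventually hd] with s hs hds
    exact hds.hasFDerivAt.comp_hasDerivAt s hs
  · have hd : DifferentiableAt ℝ (fderiv ℝ F) (γ s₀) :=
      (hF.fderiv_right (m := 1) (by norm_num)).differentiableAt (by simp)
    exact (hd.hasFDerivAt.comp_hasDerivAt s₀ h0).clm_apply hγ'

theorem partialT_eq_fderiv {w : ℝ × ℝ → ℝ} {P : ℝ × ℝ} (hw : DifferentiableAt ℝ w P) :
    partialT w P = fderiv ℝ w P (1, 0) := by
  have h : HasDerivAt (fun s : ℝ => (s, P.2)) ((1 : ℝ), (0 : ℝ)) P.1 :=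
    (hasDerivAt_id P.1).prodMk (hasDerivAt_const P.1 P.2)
  exact (HasFDerivAt.comp_hasDerivAt P.1 (f := fun s : ℝ => (s, P.2)) hw.hasFDerivAt h).deriv

theorem partialX_eq_fderiv {w : ℝ × ℝ → ℝ} {P : ℝ × ℝ} (hw : ContDiffAt ℝ 2 w P) :
    partialX 1 w P = fderiv ℝ w P (0, 1) ∧
      partialX 2 w P = fderiv ℝ (fderiv ℝ w) P (0, 1) (0, 1) := by
  have h : ∀ s : ℝ, HasDerivAt (fun s : ℝ => (P.1, s)) ((0 : ℝ), (1 : ℝ)) s := fun s =>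
    (hasDerivAt_const s P.1).prodMk (hasDerivAt_id s)
  obtain ⟨h1, h2⟩ := hasDerivAt_comp_curve (γ := fun s : ℝ => (P.1, s)) (s₀ := P.2) hw
    (Eventually.of_forall h) (hasDerivAt_const P.2 ((0 : ℝ), (1 : ℝ)))
  have h3 : deriv (fun s : ℝ => w (P.1, s)) =ᶠ[𝓝 P.2]
      fun s => fderiv ℝ w (P.1, s) (0, 1) := h1.mono fun s hs => hs.deriv
  constructor
  · rw [partialX, iteratedDeriv_one]; exact h3.self_of_nhds
  · rw [partialX, iteratedDeriv_succ, iteratedDeriv_one, h3.deriv_eq, h2.deriv]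
    simp

/-- The quadratic polynomial with 2-jet `(v₀, v_t, v_x, v_xx, v_tx, v_tt) = (v₀, a, b, c, d, e)`
at the point `p`. -/
noncomputable def jetPolynomial (p : ℝ × ℝ) (v₀ a b c d e : ℝ) (q : ℝ × ℝ) : ℝ :=
  v₀ + a * (q.1 - p.1) + b * (q.2 - p.2) + c / 2 * (q.2 - p.2) ^ 2
    + d * ((q.1 - p.1) * (q.2 - p.2)) + e / 2 * (q.1 - p.1) ^ 2

theorem contDiff_jetPolynomial (p : ℝ × ℝ) (v₀ a b c d e : ℝ) {n : WithTop ℕ∞} :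
    ContDiff ℝ n (jetPolynomial p v₀ a b c d e) := by
  unfold jetPolynomial; fun_prop

theorem fderiv_jetPolynomial (p : ℝ × ℝ) (v₀ a b c d e : ℝ) :
    fderiv ℝ (jetPolynomial p v₀ a b c d e) p (1, 0) = a ∧
      fderiv ℝ (jetPolynomial p v₀ a b c d e) p (0, 1) = b := by
  have hd := (contDiff_jetPolynomial p v₀ a b c d e (n := 1)).differentiable (by simp) p
  have h1 : HasDerivAt (fun s : ℝ => s - p.1) 1 p.1 := (hasDerivAt_id p.1).sub_const p.1
  have h2 : HasDerivAt (fun s : ℝ => s - p.2) 1 p.2 := (hasDerivAt_id p.2).sub_const p.2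
  have hd2 := (contDiff_jetPolynomial p v₀ a b c d e (n := 2)).contDiffAt (x := p)
  rw [← partialT_eq_fderiv hd, ← (partialX_eq_fderiv hd2).1, partialX, iteratedDeriv_one, partialT]
  constructor
  · have := ((h1.const_mul a).const_add v₀).add ((h1.pow 2).const_mul (e / 2))
    convert this.deriv using 1
    · congr 1; ext s; simp [jetPolynomial]
    · simp
  · have := ((h2.const_mul b).const_add v₀).add ((h2.pow 2).const_mul (c / 2))
    convert this.deriv using 1
    · congr 1; ext s; simp [jetPolynomial]
    · simp

theorem partialX_two_jetPolynomial (p : ℝ × ℝ) (v₀ a b c d e : ℝ) :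
    partialX 2 (jetPolynomial p v₀ a b c d e) p = c := by
  have h2 : ∀ s, HasDerivAt (fun s : ℝ => s - p.2) 1 s := fun s => (hasDerivAt_id s).sub_const p.2
  have h : deriv (fun s => jetPolynomial p v₀ a b c d e (p.1, s)) = fun s => b + c * (s - p.2) := by
    ext s
    have := (((h2 s).const_mul b).const_add v₀).add (((h2 s).pow 2).const_mul (c / 2))
    convert this.deriv using 1
    · congr 1; ext s; simp [jetPolynomial]
    · simp; ring
  rw [partialX, iteratedDeriv_succ, iteratedDeriv_one, h,
    (((h2 p.2).const_mul c).const_add b).deriv]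
  simp

theorem Equation.holdsAt_jetPolynomial (E : Equation) (p : ℝ × ℝ) (v₀ a b c d e : ℝ) :
    E.HoldsAt (jetPolynomial p v₀ a b c d e) p ↔ a + b ^ 2 + E.f p * c = 0 := by
  have hd := contDiff_jetPolynomial p v₀ a b c d e (n := 2)
  rw [Equation.HoldsAt, partialT_eq_fderiv (hd.differentiable (by simp) p),
    (partialX_eq_fderiv hd.contDiffAt).1, partialX_two_jetPolynomial,
    (fderiv_jetPolynomial p v₀ a b c d e).1, (fderiv_jetPolynomial p v₀ a b c d e).2]

end Curves

/-! ### The second prolongation of a point transformation -/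

section Prolongation

variable {E E' : Equation} {Φ : OpenPartialHomeomorph (ℝ × ℝ × ℝ) (ℝ × ℝ × ℝ)}

theorem IsPointTransformation.contDiffOn_components (h : IsPointTransformation E E' Φ) :
    ContDiffOn ℝ ∞ (fun y => (Φ y).1) Φ.source ∧ ContDiffOn ℝ ∞ (fun y => (Φ y).2.1) Φ.source ∧
      ContDiffOn ℝ ∞ (fun y => (Φ y).2.2) Φ.source :=
  ⟨contDiff_fst.comp_contDiffOn h.smooth,
    (contDiff_fst.comp contDiff_snd).comp_contDiffOn h.smooth,
    (contDiff_snd.comp contDiff_snd).comp_contDiffOn h.smooth⟩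

/-- The differentials `dT`, `dX`, `dV` are linearly independent at each point. -/
theorem IsPointTransformation.independent (h : IsPointTransformation E E' Φ) {z : ℝ × ℝ × ℝ}
    (hz : z ∈ Φ.source) {k l m : ℝ}
    (hklm : ∀ u, k * dirDeriv u (fun y => (Φ y).1) z + l * dirDeriv u (fun y => (Φ y).2.1) z
      + m * dirDeriv u (fun y => (Φ y).2.2) z = 0) : k = 0 ∧ l = 0 ∧ m = 0 := by
  have d1 : DifferentiableAt ℝ Φ z :=
    (h.smooth.contDiffAt (Φ.open_source.mem_nhds hz)).differentiableAt (by simp)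
  have d2 : DifferentiableAt ℝ Φ.symm (Φ z) :=
    (h.smooth_symm.contDiffAt (Φ.open_target.mem_nhds (Φ.map_source hz))).differentiableAt
      (by simp)
  have hid : ∀ u, fderiv ℝ Φ z (fderiv ℝ Φ.symm (Φ z) u) = u := by
    have e : (fun y => Φ (Φ.symm y)) =ᶠ[𝓝 (Φ z)] id := by
      filter_upwards [Φ.open_target.mem_nhds (Φ.map_source hz)] with y hy using Φ.right_inv hy
    have d1' : HasFDerivAt Φ (fderiv ℝ Φ z) (Φ.symm (Φ z)) := by
      rw [Φ.left_inv hz]; exact d1.hasFDerivAt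
    have c := (d1'.comp (Φ z) d2.hasFDerivAt).congr_of_eventuallyEq e.symm
    have := c.unique (hasFDerivAt_id _)
    intro u
    exact DFunLike.congr_fun this u
  have e1 : ∀ u, dirDeriv u (fun y => (Φ y).1) z = (fderiv ℝ Φ z u).1 := fun u => by
    rw [dirDeriv, d1.hasFDerivAt.fst.fderiv]; rfl
  have e2 : ∀ u, dirDeriv u (fun y => (Φ y).2.1) z = (fderiv ℝ Φ z u).2.1 := fun u => by
    rw [dirDeriv, d1.hasFDerivAt.snd.fst.fderiv]; rfl
  have e3 : ∀ u, dirDeriv u (fun y => (Φ y).2.2) z = (fderiv ℝ Φ z u).2.2 := fun u => by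
    rw [dirDeriv, d1.hasFDerivAt.snd.snd.fderiv]; rfl
  simp only [e1, e2, e3] at hklm
  have h1 := hklm (fderiv ℝ Φ.symm (Φ z) (1, 0, 0))
  have h2 := hklm (fderiv ℝ Φ.symm (Φ z) (0, 1, 0))
  have h3 := hklm (fderiv ℝ Φ.symm (Φ z) (0, 0, 1))
  rw [hid] at h1 h2 h3
  simpa using And.intro h1 (And.intro h2 h3)

/-- The prolongation of `Φ` to the 2-jet `(v_t, v_x, v_xx, v_tx, v_tt) = (a, b, c, d, e)` over `z`,
defined where the Jacobian `J = D_t T · D_x X - D_x T · D_t X` is nonzero. Here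
`Ta, Tb = D_t T, D_x T` and `Xa, Xb = D_t X, D_x X` are the total derivatives, and `(α, β, ρ)` stands
for `(w_t, w_x, w_xx)` at the image point. The equation for `ρ` is the chain rule for the second
derivative along the curve in the graph of `v` over the line in the direction `(-D_x T, D_t T)`,
which `(T, X)` maps to a curve with velocity `(0, J)`; `ξ` is the lift of this direction to the
graph and `q` is the second derivative of `v` in this direction. -/
theorem IsPointTransformation.exists_jet (h : IsPointTransformation E E' Φ) {z : ℝ × ℝ × ℝ}
    (hz : z ∈ Φ.source) (a b c d e : ℝ) {Ta Tb Xa Xb q : ℝ} {ξ : ℝ × ℝ × ℝ}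
    (hTa : dirDeriv (1, 0, a) (fun y => (Φ y).1) z = Ta)
    (hTb : dirDeriv (0, 1, b) (fun y => (Φ y).1) z = Tb)
    (hXa : dirDeriv (1, 0, a) (fun y => (Φ y).2.1) z = Xa)
    (hXb : dirDeriv (0, 1, b) (fun y => (Φ y).2.1) z = Xb)
    (hJ : Ta * Xb - Tb * Xa ≠ 0)
    (hξ : ξ = (-Tb, Ta, -Tb * a + Ta * b)) (hq : q = e * Tb ^ 2 - 2 * d * Ta * Tb + c * Ta ^ 2) :
    ∃ α β ρ : ℝ,
      dirDeriv (1, 0, a) (fun y => (Φ y).2.2) z = α * Ta + β * Xa ∧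
      dirDeriv (0, 1, b) (fun y => (Φ y).2.2) z = α * Tb + β * Xb ∧
      (Ta * Xb - Tb * Xa) ^ 2 * ρ
        + α * (fderiv ℝ (fderiv ℝ fun y => (Φ y).1) z ξ ξ
          + q * dirDeriv (0, 0, 1) (fun y => (Φ y).1) z)
        + β * (fderiv ℝ (fderiv ℝ fun y => (Φ y).2.1) z ξ ξ
          + q * dirDeriv (0, 0, 1) (fun y => (Φ y).2.1) z)
        = fderiv ℝ (fderiv ℝ fun y => (Φ y).2.2) z ξ ξ
          + q * dirDeriv (0, 0, 1) (fun y => (Φ y).2.2) z ∧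
      (a + b ^ 2 + E.f (base z) * c = 0 ↔ α + β ^ 2 + E'.f (base (Φ z)) * ρ = 0) := by
  obtain ⟨t₀, x₀, v₀⟩ := z
  obtain ⟨cT, cX, cV⟩ := h.contDiffOn_components
  generalize hT : (fun y => (Φ y).1) = T at *
  generalize hX : (fun y => (Φ y).2.1) = X at *
  generalize hV : (fun y => (Φ y).2.2) = V at *
  set z : ℝ × ℝ × ℝ := (t₀, x₀, v₀) with hzdef
  have hU := Φ.open_source.mem_nhds hz
  have cT' := cT.contDiffAt hU
  have cX' := cX.contDiffAt hU
  have cV' := cV.contDiffAt hU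
  have dT := (cT'.differentiableAt (by simp)).hasFDerivAt
  have dX := (cX'.differentiableAt (by simp)).hasFDerivAt
  have dV := (cV'.differentiableAt (by simp)).hasFDerivAt
  set p : ℝ × ℝ := (t₀, x₀) with hp
  set v := jetPolynomial p v₀ a b c d e with hv
  have cv : ∀ {n : WithTop ℕ∞}, ContDiff ℝ n v := contDiff_jetPolynomial p v₀ a b c d e
  have hgp : graphPt v p = z := by simp [graphPt, hv, jetPolynomial, hp, hzdef]
  have hg : HasFDerivAt (graphPt v) ((ContinuousLinearMap.fst ℝ ℝ ℝ).prod
      ((ContinuousLinearMap.snd ℝ ℝ ℝ).prod (fderiv ℝ v p))) p :=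
    hasFDerivAt_fst.prodMk (hasFDerivAt_snd.prodMk
      (cv.differentiable (n := 1) (by simp) p).hasFDerivAt)
  have cg : ContDiff ℝ ∞ (graphPt v) := contDiff_fst.prodMk (contDiff_snd.prodMk cv)
  set G := ((ContinuousLinearMap.fst ℝ ℝ ℝ).prod
      ((ContinuousLinearMap.snd ℝ ℝ ℝ).prod (fderiv ℝ v p))) with hG
  have hG1 : G (1, 0) = (1, 0, a) := by
    simp [hG, hv, (fderiv_jetPolynomial p v₀ a b c d e).1]
  have hG2 : G (0, 1) = (0, 1, b) := by
    simp [hG, hv, (fderiv_jetPolynomial p v₀ a b c d e).2]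
  -- the map `(t, x) ↦ (T, X)` along the graph of `v` is a local diffeomorphism, as `J ≠ 0`
  set H : ℝ × ℝ → ℝ × ℝ := fun q => (T (graphPt v q), X (graphPt v q)) with hH
  have cH : ContDiffAt ℝ ∞ H p :=
    (ContDiffAt.comp p (hgp ▸ cT') cg.contDiffAt).prodMk
      (ContDiffAt.comp p (hgp ▸ cX') cg.contDiffAt)
  have dTg : HasFDerivAt (fun q => T (graphPt v q)) ((fderiv ℝ T z).comp G) p :=
    HasFDerivAt.comp p (by rw [hgp]; exact dT) hg
  have dXg : HasFDerivAt (fun q => X (graphPt v q)) ((fderiv ℝ X z).comp G) p :=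
    HasFDerivAt.comp p (by rw [hgp]; exact dX) hg
  have dVg : HasFDerivAt (fun q => V (graphPt v q)) ((fderiv ℝ V z).comp G) p :=
    HasFDerivAt.comp p (by rw [hgp]; exact dV) hg
  set A : ℝ × ℝ →L[ℝ] ℝ × ℝ := ((fderiv ℝ T z).comp G).prod ((fderiv ℝ X z).comp G) with hA
  have dH : HasFDerivAt H A p := dTg.prodMk dXg
  have hA1 : A (1, 0) = (Ta, Xa) := by
    rw [← hTa, ← hXa, dirDeriv, dirDeriv, ← hG1]; rfl
  have hA2 : A (0, 1) = (Tb, Xb) := by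
    rw [← hTb, ← hXb, dirDeriv, dirDeriv, ← hG2]; rfl
  have hAinj : Function.Injective (A : ℝ × ℝ →ₗ[ℝ] ℝ × ℝ) := by
    rw [injective_iff_map_eq_zero]
    rintro ⟨r, s⟩ hrs
    have e0 : ((r, s) : ℝ × ℝ) = r • (1, 0) + s • (0, 1) := by simp
    rw [ContinuousLinearMap.coe_coe, e0, map_add, map_smul, map_smul, hA1, hA2] at hrs
    simp only [Prod.smul_mk, smul_eq_mul, Prod.mk_add_mk, Prod.mk_eq_zero] at hrs
    have e1 : (Ta * Xb - Tb * Xa) * r = 0 := by linear_combination Xb * hrs.1 - Tb * hrs.2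
    have e2 : (Ta * Xb - Tb * Xa) * s = 0 := by linear_combination Ta * hrs.2 - Xa * hrs.1
    simpa [hJ] using And.intro e1 e2
  set A' : (ℝ × ℝ) ≃L[ℝ] ℝ × ℝ := ContinuousLinearEquiv.ofBijective A
    (LinearMap.ker_eq_bot.2 hAinj)
    (LinearMap.range_eq_top.2 (LinearMap.injective_iff_surjective.1 hAinj)) with hA'
  have dH' : HasFDerivAt H (A' : ℝ × ℝ →L[ℝ] ℝ × ℝ) p := by
    convert dH using 1
    ext <;> simp [hA']
  have hn : (∞ : WithTop ℕ∞) ≠ 0 := by simp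
  set K := cH.localInverse dH' hn with hK
  have cK : ContDiffAt ℝ ∞ K (H p) := cH.to_localInverse dH' hn
  have hKH : ∀ᶠ q in 𝓝 p, K (H q) = q :=
    (cH.hasStrictFDerivAt' dH' hn).eventually_left_inverse
  have hKp : K (H p) = p := hKH.self_of_nhds
  -- the transformed function
  set w : ℝ × ℝ → ℝ := fun P => V (graphPt v (K P)) with hw
  have cw : ContDiffAt ℝ ∞ w (H p) := by
    refine ContDiffAt.comp (H p) ?_ (cg.contDiffAt.comp (H p) cK)
    simpa [hKp, hgp] using cV'
  have hbase : ∀ q, base (Φ (graphPt v q)) = H q := fun q =>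
    Prod.ext (congr_fun hT _) (congr_fun hX _)
  have hcarry : CarriesGraph Φ v w p := by
    filter_upwards [hKH] with q hq
    have e1 : w (base (Φ (graphPt v q))) = V (graphPt v q) := by
      rw [hbase]; simp only [hw, hq]
    exact Prod.ext rfl (Prod.ext rfl ((congr_fun hV _).trans e1.symm))
  have hwH : (fun q => w (H q)) =ᶠ[𝓝 p] fun q => V (graphPt v q) := by
    filter_upwards [hKH] with q hq
    simp only [hw, hq]
  have cw2 : ContDiffAt ℝ 2 w (H p) := cw.of_le two_le_infty
  have heq := h.maps_equation p v w (hgp ▸ hz) cv.contDiffAt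
    (by rw [hbase]; exact cw2) hcarry
  have dw := cw2.differentiableAt (by simp)
  rw [hv, Equation.holdsAt_jetPolynomial, ← hv, hbase, Equation.HoldsAt, partialT_eq_fderiv dw,
    (partialX_eq_fderiv cw2).1, (partialX_eq_fderiv cw2).2] at heq
  have hchain : (fderiv ℝ w (H p)).comp A = (fderiv ℝ V z).comp G :=
    ((HasFDerivAt.comp p dw.hasFDerivAt dH).congr_of_eventuallyEq hwH.symm).unique dVg
  have hlin : ∀ r s : ℝ, fderiv ℝ w (H p) (r, s)
      = fderiv ℝ w (H p) (1, 0) * r + fderiv ℝ w (H p) (0, 1) * s := fun r s => by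
    have e0 : ((r, s) : ℝ × ℝ) = r • (1, 0) + s • (0, 1) := by simp
    rw [e0, map_add, map_smul, map_smul]; simp only [smul_eq_mul]; ring
  refine ⟨fderiv ℝ w (H p) (1, 0), fderiv ℝ w (H p) (0, 1),
    fderiv ℝ (fderiv ℝ w) (H p) (0, 1) (0, 1), ?_, ?_, ?_, ?_⟩
  · have := DFunLike.congr_fun hchain (1, 0)
    simp only [ContinuousLinearMap.comp_apply, hA1, hG1] at this
    rw [hlin] at this
    exact this.symm
  · have := DFunLike.congr_fun hchain (0, 1)
    simp only [ContinuousLinearMap.comp_apply, hA2, hG2] at this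
    rw [hlin] at this
    exact this.symm
  · -- compare second derivatives along the curve `σ` in the graph of `v`, which lies
    -- over the line `s ↦ p + s (-D_x T, D_t T)`
    set m : ℝ := -Tb * a + Ta * b with hm
    set σ : ℝ → ℝ × ℝ × ℝ := fun s =>
      (t₀ + s * -Tb, x₀ + s * Ta, v₀ + (s * m + q / 2 * s ^ 2)) with hσ
    set σ' : ℝ → ℝ × ℝ × ℝ := fun s => (-Tb, Ta, m + q * s) with hσ'
    have dσ : ∀ s, HasDerivAt σ (σ' s) s := fun s => by
      refine HasDerivAt.prodMk ?_ (HasDerivAt.prodMk ?_ ?_)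
      · simpa using ((hasDerivAt_id s).mul_const (-Tb)).const_add t₀
      · simpa using ((hasDerivAt_id s).mul_const Ta).const_add x₀
      · convert (((hasDerivAt_id' s).mul_const m).add
          (((hasDerivAt_id' s).pow 2).const_mul (q / 2))).const_add v₀ using 1
        simp; ring
    have dσ' : HasDerivAt σ' (q • ((0 : ℝ), (0 : ℝ), (1 : ℝ))) 0 := by
      have : HasDerivAt (fun s : ℝ => m + q * s) q 0 := by
        simpa using ((hasDerivAt_id (0 : ℝ)).const_mul q).const_add m
      simpa using (hasDerivAt_const (0 : ℝ) (-Tb)).prodMk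
        ((hasDerivAt_const (0 : ℝ) Ta).prodMk this)
    have hσ0 : σ 0 = z := by simp [hσ, hzdef]
    have hσ'0 : σ' 0 = ξ := by simp [hσ', hξ, hm]
    have hσg : ∀ s, σ s = graphPt v (t₀ + s * -Tb, x₀ + s * Ta) := fun s => by
      simp only [hσ, graphPt, hv, jetPolynomial, hp, hq, hm]
      refine Prod.ext rfl (Prod.ext rfl ?_)
      simp only
      ring
    have hs2 : ∀ {F : ℝ × ℝ × ℝ → ℝ}, ContDiffAt ℝ ∞ F z → ContDiffAt ℝ 2 F (σ 0) := fun hF => by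
      rw [hσ0]; exact hF.of_le two_le_infty
    obtain ⟨t1, t2⟩ := hasDerivAt_comp_curve (hs2 cT') (Eventually.of_forall dσ) dσ'
    obtain ⟨x1, x2⟩ := hasDerivAt_comp_curve (hs2 cX') (Eventually.of_forall dσ) dσ'
    obtain ⟨v1, v2⟩ := hasDerivAt_comp_curve (hs2 cV') (Eventually.of_forall dσ) dσ'
    have γ1 : ∀ᶠ s in 𝓝 (0 : ℝ), HasDerivAt (fun s => (T (σ s), X (σ s)))
        (fderiv ℝ T (σ s) (σ' s), fderiv ℝ X (σ s) (σ' s)) s := by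
      filter_upwards [t1, x1] with s ht hx using ht.prodMk hx
    have hγ0 : (T (σ 0), X (σ 0)) = H p := by rw [hσ0, ← hgp]
    obtain ⟨w1, w2⟩ := hasDerivAt_comp_curve (F := w) (γ := fun s => (T (σ s), X (σ s)))
      (by rw [hγ0]; exact cw2) γ1 (t2.prodMk x2)
    have hcomp : (fun s => w (T (σ s), X (σ s))) =ᶠ[𝓝 0] fun s => V (σ s) := by
      have hc : Tendsto (fun s : ℝ => (t₀ + s * -Tb, x₀ + s * Ta)) (𝓝 0) (𝓝 p) := by
        have : Continuous fun s : ℝ => (t₀ + s * -Tb, x₀ + s * Ta) := by fun_prop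
        simpa [hp] using this.tendsto 0
      filter_upwards [hc.eventually hwH] with s hs
      rw [hσg]; exact hs
    have hder : ∀ᶠ s in 𝓝 (0 : ℝ), fderiv ℝ V (σ s) (σ' s)
        = fderiv ℝ w (T (σ s), X (σ s)) (fderiv ℝ T (σ s) (σ' s), fderiv ℝ X (σ s) (σ' s)) := by
      filter_upwards [hcomp.eventuallyEq_nhds, w1, v1] with s hs hw hv
      exact (hv.congr_of_eventuallyEq hs).unique hw
    have hfin := (w2.congr_of_eventuallyEq hder).unique v2
    rw [hγ0, hσ0, hσ'0] at hfin
    have hξG : ξ = G (-Tb, Ta) := by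
      have : ((-Tb, Ta) : ℝ × ℝ) = -Tb • (1, 0) + Ta • (0, 1) := by simp
      rw [this, map_add, map_smul, map_smul, hG1, hG2, hξ]; simp [hm]
    have hγ' : (fderiv ℝ T z ξ, fderiv ℝ X z ξ) = (Ta * Xb - Tb * Xa) • ((0 : ℝ), (1 : ℝ)) := by
      have e0 : (fderiv ℝ T z ξ, fderiv ℝ X z ξ) = A (-Tb, Ta) := by rw [hξG]; rfl
      have : ((-Tb, Ta) : ℝ × ℝ) = -Tb • (1, 0) + Ta • (0, 1) := by simp
      rw [e0, this, map_add, map_smul, map_smul, hA1, hA2]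
      simp only [Prod.smul_mk, Prod.mk_add_mk, smul_eq_mul]
      refine Prod.ext ?_ ?_ <;> simp only <;> ring
    rw [hγ', hlin] at hfin
    simp only [map_smul, smul_apply, smul_eq_mul] at hfin
    simp only [dirDeriv]
    linear_combination hfin
  · have e1 : base z = p := rfl
    have e2 : base (Φ z) = H p := by rw [← hbase, hgp]
    rw [e1, e2]; exact heq

end Prolongation
/-! ### Derivation of the determining equations -/

section DeterminingEquations

theorem dirDeriv_eq_partials (F : ℝ × ℝ × ℝ → ℝ) (z u : ℝ × ℝ × ℝ) :
    dirDeriv u F z = u.1 * dirDeriv (1, 0, 0) F z + u.2.1 * dirDeriv (0, 1, 0) F z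
      + u.2.2 * dirDeriv (0, 0, 1) F z := by
  have : u = u.1 • ((1 : ℝ), (0 : ℝ), (0 : ℝ)) + u.2.1 • ((0 : ℝ), (1 : ℝ), (0 : ℝ))
      + u.2.2 • ((0 : ℝ), (0 : ℝ), (1 : ℝ)) := by simp
  simp only [dirDeriv]
  conv_lhs => rw [this]
  simp only [map_add, map_smul, smul_eq_mul]

variable {E E' : Equation} {Φ : OpenPartialHomeomorph (ℝ × ℝ × ℝ) (ℝ × ℝ × ℝ)}

theorem IsPointTransformation.f_ne_zero (h : IsPointTransformation E E' Φ) {z : ℝ × ℝ × ℝ}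
    (hz : z ∈ Φ.source) : E.f (base z) ≠ 0 :=
  E.f_ne_zero _ (h.base_source ▸ mem_image_of_mem base hz)

theorem IsPointTransformation.f_image_ne_zero (h : IsPointTransformation E E' Φ)
    {z : ℝ × ℝ × ℝ} (hz : z ∈ Φ.source) : E'.f (base (Φ z)) ≠ 0 :=
  E'.f_ne_zero _ (h.base_target ▸ mem_image_of_mem base (Φ.map_source hz))

/-- `T_x = T_v = 0`. If `D_x T ≠ 0` for some 1-jet, then `v_tt`, which does not occur in the equation
for `v`, enters `w_xx` with a nonzero coefficient, so that the equation for `w` would restrict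
it. -/
theorem IsPointTransformation.dirDeriv_fst_eq_zero (h : IsPointTransformation E E' Φ)
    {z : ℝ × ℝ × ℝ} (hz : z ∈ Φ.source) :
    dirDeriv (0, 1, 0) (fun y => (Φ y).1) z = 0 ∧
      dirDeriv (0, 0, 1) (fun y => (Φ y).1) z = 0 := by
  have jet := fun a b c d e {Ta Tb Xa Xb q} {ξ : ℝ × ℝ × ℝ} =>
    h.exists_jet hz a b c d e (Ta := Ta) (Tb := Tb) (Xa := Xa) (Xb := Xb) (q := q) (ξ := ξ)
  have ind := fun {k l m : ℝ} => h.independent hz (k := k) (l := l) (m := m)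
  have hf := h.f_ne_zero hz
  have hf' := h.f_image_ne_zero hz
  generalize (fun y => (Φ y).1) = T at *
  generalize (fun y => (Φ y).2.1) = X at *
  generalize (fun y => (Φ y).2.2) = V at *
  suffices H : ∀ b, dirDeriv (0, 1, b) T z = 0 by
    have h0 := H 0
    have h1 := H 1
    rw [dirDeriv_eq_partials] at h1
    simp only [h0] at h1
    exact ⟨h0, by linarith⟩
  intro b
  by_contra hm
  have pa : ∀ (F : ℝ × ℝ × ℝ → ℝ) a, dirDeriv (1, 0, a) F z
      = dirDeriv (1, 0, 0) F z + a * dirDeriv (0, 0, 1) F z := fun F a => by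
    rw [dirDeriv_eq_partials]; ring
  have pb : ∀ (F : ℝ × ℝ × ℝ → ℝ), dirDeriv (0, 1, 0) F z
      = dirDeriv (0, 1, b) F z - b * dirDeriv (0, 0, 1) F z := fun F => by
    rw [dirDeriv_eq_partials F z (0, 1, b)]; ring
  -- `J` is affine in `a = v_t`, and vanishes for `a = 0, 1` only if `dT` and `dX` are dependent
  obtain ⟨a, hJ⟩ : ∃ a, dirDeriv (1, 0, a) T z * dirDeriv (0, 1, b) X z
      - dirDeriv (0, 1, b) T z * dirDeriv (1, 0, a) X z ≠ 0 := by
    by_contra! hJ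
    have j0 := hJ 0
    have j1 := hJ 1
    rw [pa T, pa X] at j1
    refine hm (neg_eq_zero.1 (ind (k := dirDeriv (0, 1, b) X z) (l := - dirDeriv (0, 1, b) T z)
      (m := 0) fun u => ?_).2.1)
    rw [dirDeriv_eq_partials T z u, dirDeriv_eq_partials X z u, pb T, pb X]
    linear_combination u.1 * j0 + (u.2.2 - b * u.2.1) * (j1 - j0)
  -- the jets over the same 1-jet which satisfy the equation form a line in the direction `v_tt`
  have jet' := fun e => jet a b (-(a + b ^ 2) / E.f (base z)) 0 e rfl rfl rfl rfl hJ rfl rfl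
  have hsol : a + b ^ 2 + E.f (base z) * (-(a + b ^ 2) / E.f (base z)) = 0 := by
    field_simp; ring
  obtain ⟨α, β, ρ, h1, h2, h3, h4⟩ := jet' 0
  obtain ⟨α', β', ρ', h1', h2', h3', h4'⟩ := jet' 1
  have hα : α' = α := mul_left_cancel₀ hJ (by
    linear_combination (h1 - h1') * dirDeriv (0, 1, b) X z - (h2 - h2') * dirDeriv (1, 0, a) X z)
  have hβ : β' = β := mul_left_cancel₀ hJ (by
    linear_combination (h2 - h2') * dirDeriv (1, 0, a) T z - (h1 - h1') * dirDeriv (0, 1, b) T z)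
  subst hα hβ
  have k := h4.1 hsol
  have k' := h4'.1 hsol
  -- the coefficient of `w_xx` is nonzero, so `w_xx` does not depend on `v_tt`
  have hρ : ρ' = ρ := mul_left_cancel₀ hf' (by linear_combination k' - k)
  subst hρ
  -- the coefficient of `v_tt` in `J² w_xx` is `(D_x T)² (V_v - w_t T_v - w_x X_v)`, and its second
  -- factor is nonzero by the independence of `dT`, `dX`, `dV`
  have hl : dirDeriv (0, 0, 1) V z = α' * dirDeriv (0, 0, 1) T z + β' * dirDeriv (0, 0, 1) X z :=
    mul_left_cancel₀ (pow_ne_zero 2 hm) (by linear_combination h3 - h3')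
  have := (ind (k := α') (l := β') (m := -1) fun u => by
    rw [dirDeriv_eq_partials T, dirDeriv_eq_partials X, dirDeriv_eq_partials V, pb T, pb X, pb V]
    rw [pa T, pa X, pa V] at h1
    linear_combination -u.1 * h1 - u.2.1 * h2 - (u.2.2 - a * u.1 - b * u.2.1) * hl).2.2
  norm_num at this

theorem IsPointTransformation.dirDeriv_dirDeriv_fst_eq_zero (h : IsPointTransformation E E' Φ)
    {z : ℝ × ℝ × ℝ} (hz : z ∈ Φ.source) (u : ℝ × ℝ × ℝ) (r s : ℝ) :
    dirDeriv u (dirDeriv (0, r, s) (fun y => (Φ y).1)) z = 0 := by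
  rw [dirDeriv_congr Φ.open_source (G := fun _ => 0) (fun y hy => ?_) hz, dirDeriv_const]
  rw [dirDeriv_eq_partials, (h.dirDeriv_fst_eq_zero hy).1, (h.dirDeriv_fst_eq_zero hy).2]
  simp

theorem IsPointTransformation.dirDeriv_t_fst_ne_zero (h : IsPointTransformation E E' Φ)
    {z : ℝ × ℝ × ℝ} (hz : z ∈ Φ.source) : dirDeriv (1, 0, 0) (fun y => (Φ y).1) z ≠ 0 := by
  intro h0
  refine one_ne_zero (h.independent hz (k := 1) (l := 0) (m := 0) fun u => ?_).1
  rw [dirDeriv_eq_partials, (h.dirDeriv_fst_eq_zero hz).1, (h.dirDeriv_fst_eq_zero hz).2, h0]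
  simp

/-- The image under `Φ` of the 2-jet with `v_x = b`, `v_xx = c`, `v_tx = v_tt = 0` and with `v_t`
determined by the equation. As `T = T(t)`, the prolongation is defined when `D_x X ≠ 0`, and the
formula for `ρ` involves only derivatives along the lifted direction `(0, 1, b)`. -/
theorem IsPointTransformation.exists_jet_of_holds (h : IsPointTransformation E E' Φ)
    {z : ℝ × ℝ × ℝ} (hz : z ∈ Φ.source) (b c : ℝ)
    (hb : dirDeriv (0, 1, b) (fun y => (Φ y).2.1) z ≠ 0) :
    ∃ α β ρ : ℝ,
      dirDeriv (1, 0, -b ^ 2 - E.f (base z) * c) (fun y => (Φ y).2.2) z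
        = α * dirDeriv (1, 0, 0) (fun y => (Φ y).1) z
          + β * dirDeriv (1, 0, -b ^ 2 - E.f (base z) * c) (fun y => (Φ y).2.1) z ∧
      dirDeriv (0, 1, b) (fun y => (Φ y).2.2) z
        = β * dirDeriv (0, 1, b) (fun y => (Φ y).2.1) z ∧
      dirDeriv (0, 1, b) (fun y => (Φ y).2.1) z ^ 2 * ρ
        + β * (dirDeriv (0, 1, b) (dirDeriv (0, 1, b) fun y => (Φ y).2.1) z
          + c * dirDeriv (0, 0, 1) (fun y => (Φ y).2.1) z)
        = dirDeriv (0, 1, b) (dirDeriv (0, 1, b) fun y => (Φ y).2.2) z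
          + c * dirDeriv (0, 0, 1) (fun y => (Φ y).2.2) z ∧
      α + β ^ 2 + E'.f (base (Φ z)) * ρ = 0 := by
  have jet := fun a {Ta Tb Xa Xb q} {ξ : ℝ × ℝ × ℝ} =>
    h.exists_jet hz a b c 0 0 (Ta := Ta) (Tb := Tb) (Xa := Xa) (Xb := Xb) (q := q) (ξ := ξ)
  obtain ⟨cT, cX, cV⟩ := h.contDiffOn_components
  have hTt := h.dirDeriv_t_fst_ne_zero hz
  obtain ⟨hTx, hTv⟩ := h.dirDeriv_fst_eq_zero hz
  have hTT := h.dirDeriv_dirDeriv_fst_eq_zero hz (0, 1, b) 1 b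
  generalize (fun y => (Φ y).1) = T at *
  generalize (fun y => (Φ y).2.1) = X at *
  generalize (fun y => (Φ y).2.2) = V at *
  have hTa : ∀ a, dirDeriv (1, 0, a) T z = dirDeriv (1, 0, 0) T z := fun a => by
    rw [dirDeriv_eq_partials, hTx, hTv]; ring
  have hTb : dirDeriv (0, 1, b) T z = 0 := by
    rw [dirDeriv_eq_partials, hTx, hTv]; ring
  set τ := dirDeriv (1, 0, 0) T z with hτ
  obtain ⟨α, β, ρ, h1, h2, h3, h4⟩ := jet (-b ^ 2 - E.f (base z) * c) (ξ := τ • (0, 1, b))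
    (hTa _) hTb rfl rfl (by simpa using ⟨hTt, hb⟩) (by simp) rfl
  simp only [map_smul, smul_apply, smul_eq_mul, ← dirDeriv_dirDeriv Φ.open_source cT hz,
    ← dirDeriv_dirDeriv Φ.open_source cX hz, ← dirDeriv_dirDeriv Φ.open_source cV hz, hTT, hTv]
    at h3
  refine ⟨α, β, ρ, h1, by linear_combination h2, ?_, h4.1 (by ring)⟩
  apply mul_left_cancel₀ (pow_ne_zero 2 hTt)
  linear_combination h3

theorem IsPointTransformation.dirDeriv_snd_ne_zero (h : IsPointTransformation E E' Φ)
    {z : ℝ × ℝ × ℝ} (hz : z ∈ Φ.source) :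
    dirDeriv (0, 1, 0) (fun y => (Φ y).2.1) z ≠ 0 ∨
      dirDeriv (0, 0, 1) (fun y => (Φ y).2.1) z ≠ 0 := by
  by_contra! H
  refine h.dirDeriv_t_fst_ne_zero hz (neg_eq_zero.1 (h.independent hz
    (k := dirDeriv (1, 0, 0) (fun y => (Φ y).2.1) z)
    (l := - dirDeriv (1, 0, 0) (fun y => (Φ y).1) z) (m := 0) fun u => ?_).2.1)
  rw [dirDeriv_eq_partials _ z u, dirDeriv_eq_partials (fun y => (Φ y).2.1) z u, H.1, H.2,
    (h.dirDeriv_fst_eq_zero hz).1, (h.dirDeriv_fst_eq_zero hz).2]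
  ring

/-- The coefficient of `v_xx` in the transformed equation gives `f' T_t = f (D_x X) ^ 2`, for every
value `b` of `v_x` with `D_x X ≠ 0`. -/
theorem IsPointTransformation.f_image_mul (h : IsPointTransformation E E' Φ)
    {z : ℝ × ℝ × ℝ} (hz : z ∈ Φ.source) (b : ℝ)
    (hb : dirDeriv (0, 1, b) (fun y => (Φ y).2.1) z ≠ 0) :
    E'.f (base (Φ z)) * dirDeriv (1, 0, 0) (fun y => (Φ y).1) z
      = E.f (base z) * dirDeriv (0, 1, b) (fun y => (Φ y).2.1) z ^ 2 := by
  obtain ⟨α, β, ρ, h1, h2, h3, h4⟩ := h.exists_jet_of_holds hz b 0 hb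
  obtain ⟨α', β', ρ', h1', h2', h3', h4'⟩ := h.exists_jet_of_holds hz b 1 hb
  have ind := fun {k l m : ℝ} => h.independent hz (k := k) (l := l) (m := m)
  obtain ⟨hTx, hTv⟩ := h.dirDeriv_fst_eq_zero hz
  generalize (fun y => (Φ y).1) = T at *
  generalize (fun y => (Φ y).2.1) = X at *
  generalize (fun y => (Φ y).2.2) = V at *
  obtain rfl : β' = β := mul_right_cancel₀ hb (by rw [← h2, ← h2'])
  have pa : ∀ (F : ℝ × ℝ × ℝ → ℝ) a, dirDeriv (1, 0, a) F z
      = dirDeriv (1, 0, 0) F z + a * dirDeriv (0, 0, 1) F z := fun F a => by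
    rw [dirDeriv_eq_partials]; ring
  have pb : ∀ (F : ℝ × ℝ × ℝ → ℝ), dirDeriv (0, 1, 0) F z
      = dirDeriv (0, 1, b) F z - b * dirDeriv (0, 0, 1) F z := fun F => by
    rw [dirDeriv_eq_partials F z (0, 1, b)]; ring
  have hTb : dirDeriv (0, 1, b) T z = 0 := by
    rw [dirDeriv_eq_partials, hTx, hTv]; ring
  rw [pa V, pa X] at h1 h1'
  -- the coefficient `V_v - w_x X_v` of `v_xx` in `(D_x X)² w_xx`
  have hl : dirDeriv (0, 0, 1) V z - β' * dirDeriv (0, 0, 1) X z ≠ 0 := by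
    intro hl
    have := (ind (k := α) (l := β') (m := -1) fun u => by
      rw [dirDeriv_eq_partials T, dirDeriv_eq_partials X, dirDeriv_eq_partials V, pb T, pb X, pb V,
        hTb, hTv]
      linear_combination -u.1 * h1 - u.2.1 * h2
        - (u.2.2 - (-b ^ 2 - E.f (base z) * 0) * u.1 - b * u.2.1) * hl).2.2
    norm_num at this
  apply mul_left_cancel₀ hl
  linear_combination E'.f (base (Φ z)) * dirDeriv (1, 0, 0) T z * (h3 - h3')
    + dirDeriv (0, 1, b) X z ^ 2 * (dirDeriv (1, 0, 0) T z * (h4' - h4) + (h1' - h1))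

/-- `X_v = 0`: otherwise `D_x X = X_x + b X_v` takes both values `1` and `2`, which contradicts
`f' T_t = f (D_x X) ^ 2`. -/
theorem IsPointTransformation.dirDeriv_v_snd_eq_zero (h : IsPointTransformation E E' Φ)
    {z : ℝ × ℝ × ℝ} (hz : z ∈ Φ.source) :
    dirDeriv (0, 0, 1) (fun y => (Φ y).2.1) z = 0 := by
  by_contra hv
  have hf := h.f_ne_zero hz
  have key := h.f_image_mul hz
  generalize (fun y => (Φ y).2.1) = X at *
  have p : ∀ k, dirDeriv (0, 1, (k - dirDeriv (0, 1, 0) X z) / dirDeriv (0, 0, 1) X z) X z = k :=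
    fun k => by
      rw [dirDeriv_eq_partials]; field_simp; ring
  have k1 := key _ (by rw [p 1]; norm_num)
  have k2 := key _ (by rw [p 2]; norm_num)
  rw [p] at k1 k2
  exact hf (by linarith)

theorem IsPointTransformation.dirDeriv_x_snd_ne_zero (h : IsPointTransformation E E' Φ)
    {z : ℝ × ℝ × ℝ} (hz : z ∈ Φ.source) :
    dirDeriv (0, 1, 0) (fun y => (Φ y).2.1) z ≠ 0 :=
  (h.dirDeriv_snd_ne_zero hz).resolve_right fun H => H (h.dirDeriv_v_snd_eq_zero hz)

theorem IsPointTransformation.dirDeriv_v_third_ne_zero (h : IsPointTransformation E E' Φ)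
    {z : ℝ × ℝ × ℝ} (hz : z ∈ Φ.source) :
    dirDeriv (0, 0, 1) (fun y => (Φ y).2.2) z ≠ 0 := by
  intro H
  have hTt := h.dirDeriv_t_fst_ne_zero hz
  have hXx := h.dirDeriv_x_snd_ne_zero hz
  obtain ⟨hTx, hTv⟩ := h.dirDeriv_fst_eq_zero hz
  have hXv := h.dirDeriv_v_snd_eq_zero hz
  have ind := fun {k l m : ℝ} => h.independent hz (k := k) (l := l) (m := m)
  generalize (fun y => (Φ y).1) = T at *
  generalize (fun y => (Φ y).2.1) = X at *
  generalize (fun y => (Φ y).2.2) = V at *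
  -- otherwise `dT`, `dX`, `dV` all annihilate `∂_v`
  refine one_ne_zero (ind (m := 1) (l := - dirDeriv (0, 1, 0) V z / dirDeriv (0, 1, 0) X z)
    (k := (dirDeriv (0, 1, 0) V z / dirDeriv (0, 1, 0) X z * dirDeriv (1, 0, 0) X z
      - dirDeriv (1, 0, 0) V z) / dirDeriv (1, 0, 0) T z) fun u => ?_).2.2
  rw [dirDeriv_eq_partials T z u, dirDeriv_eq_partials X z u, dirDeriv_eq_partials V z u,
    H, hTx, hTv, hXv]
  field_simp
  ring

theorem dirDeriv_dirDeriv_eq_partials {U : Set (ℝ × ℝ × ℝ)} (hU : IsOpen U)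
    {F : ℝ × ℝ × ℝ → ℝ} (hF : ContDiffOn ℝ ∞ F U) {z : ℝ × ℝ × ℝ} (hz : z ∈ U) (b : ℝ) :
    dirDeriv (0, 1, b) (dirDeriv (0, 1, b) F) z
      = dirDeriv (0, 1, 0) (dirDeriv (0, 1, 0) F) z
        + 2 * b * dirDeriv (0, 1, 0) (dirDeriv (0, 0, 1) F) z
        + b ^ 2 * dirDeriv (0, 0, 1) (dirDeriv (0, 0, 1) F) z := by
  have hc := dirDeriv_comm hU hF hz (0, 1, 0) (0, 0, 1)
  simp only [dirDeriv_dirDeriv hU hF hz] at hc ⊢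
  have : ((0 : ℝ), (1 : ℝ), b) = (0, 1, 0) + b • (0, 0, 1) := by simp
  simp only [this, map_add, map_smul, add_apply, smul_apply, smul_eq_mul]
  linear_combination -b * hc

/-- The part of the transformed equation without `v_xx`, where `μ = T_t / X_x ^ 2` and
`N = (X_t + f X_xx) / X_x`: a polynomial in `b = v_x` which vanishes identically. -/
theorem IsPointTransformation.determining_equation (h : IsPointTransformation E E' Φ)
    {z : ℝ × ℝ × ℝ} (hz : z ∈ Φ.source) (b : ℝ) {T X V : ℝ × ℝ × ℝ → ℝ} {μ N : ℝ}
    (hT : T = fun y => (Φ y).1) (hX : X = fun y => (Φ y).2.1) (hV : V = fun y => (Φ y).2.2)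
    (hμ : μ * dirDeriv (0, 1, 0) X z ^ 2 = dirDeriv (1, 0, 0) T z)
    (hN : N * dirDeriv (0, 1, 0) X z
      = dirDeriv (1, 0, 0) X z + E.f (base z) * dirDeriv (0, 1, 0) (dirDeriv (0, 1, 0) X) z) :
    dirDeriv (1, 0, 0) V z - b ^ 2 * dirDeriv (0, 0, 1) V z
      - N * (dirDeriv (0, 1, 0) V z + b * dirDeriv (0, 0, 1) V z)
      + μ * (dirDeriv (0, 1, 0) V z + b * dirDeriv (0, 0, 1) V z) ^ 2
      + E.f (base z) * (dirDeriv (0, 1, 0) (dirDeriv (0, 1, 0) V) z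
        + 2 * b * dirDeriv (0, 1, 0) (dirDeriv (0, 0, 1) V) z
        + b ^ 2 * dirDeriv (0, 0, 1) (dirDeriv (0, 0, 1) V) z) = 0 := by
  obtain ⟨-, cX, cV⟩ := h.contDiffOn_components
  have hXx := h.dirDeriv_x_snd_ne_zero hz
  have hXv := fun y (hy : y ∈ Φ.source) => h.dirDeriv_v_snd_eq_zero hy
  have hf := h.f_image_mul hz 0 hXx
  have jet := h.exists_jet_of_holds hz b 0
  rw [← hT] at hf jet
  rw [← hX] at hf hXx hXv cX jet
  rw [← hV] at cV jet
  have hXv' := hXv z hz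
  have hXuv : ∀ u, dirDeriv u (dirDeriv (0, 0, 1) X) z = 0 := fun u => by
    rw [dirDeriv_congr Φ.open_source hXv hz, dirDeriv_const]
  have hXb : dirDeriv (0, 1, b) X z = dirDeriv (0, 1, 0) X z := by
    rw [dirDeriv_eq_partials, hXv']; ring
  obtain ⟨α, β, ρ, h1, h2, h3, h4⟩ := jet (by rwa [hXb])
  rw [dirDeriv_dirDeriv_eq_partials Φ.open_source cX hz,
    dirDeriv_dirDeriv_eq_partials Φ.open_source cV hz, hXuv, hXuv, hXb] at h3
  rw [hXb, dirDeriv_eq_partials V z (0, 1, b)] at h2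
  rw [dirDeriv_eq_partials V, dirDeriv_eq_partials X z (1, 0, _), hXv'] at h1
  have hμ' : μ * (β * dirDeriv (0, 1, 0) X z) ^ 2 = dirDeriv (1, 0, 0) T z * β ^ 2 := by
    linear_combination β ^ 2 * hμ
  have h2' : dirDeriv (0, 1, 0) V z + b * dirDeriv (0, 0, 1) V z
      = β * dirDeriv (0, 1, 0) X z := by linear_combination h2
  rw [h2', hμ']
  linear_combination h1 + dirDeriv (1, 0, 0) T z * h4 - E.f (base z) * h3 - ρ * hf - β * hN

end DeterminingEquations
/-! ### The form of the point transformations and the three subclasses -/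

section PointTransformations

variable {E E' : Equation} {Φ : OpenPartialHomeomorph (ℝ × ℝ × ℝ) (ℝ × ℝ × ℝ)}

theorem dirDeriv_comp_base {f : ℝ × ℝ → ℝ} {z : ℝ × ℝ × ℝ}
    (hf : DifferentiableAt ℝ f (base z)) : dirDeriv (0, 0, 1) (fun y => f (base y)) z = 0 := by
  have hb : HasFDerivAt base ((ContinuousLinearMap.fst ℝ ℝ (ℝ × ℝ)).prod
      ((ContinuousLinearMap.fst ℝ ℝ ℝ).comp (ContinuousLinearMap.snd ℝ ℝ (ℝ × ℝ)))) z :=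
    hasFDerivAt_fst.prodMk hasFDerivAt_snd.fst
  have := (HasFDerivAt.comp z hf.hasFDerivAt hb).fderiv
  change fderiv ℝ (f ∘ base) z _ = 0
  rw [this]
  exact (fderiv ℝ f (base z)).map_zero

/-- `T_t / X_x ^ 2` is a constant `k`, hence `X_x` depends on `t` only and `X_xx = 0`. -/
theorem IsPointTransformation.exists_const_and_second_deriv_eq_zero
    (h : IsPointTransformation E E' Φ) :
    (∃ k : ℝ, ∀ z ∈ Φ.source, k * dirDeriv (0, 1, 0) (fun y => (Φ y).2.1) z ^ 2
        = dirDeriv (1, 0, 0) (fun y => (Φ y).1) z) ∧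
      ∀ z ∈ Φ.source, dirDeriv (0, 1, 0) (dirDeriv (0, 1, 0) fun y => (Φ y).2.1) z = 0 := by
  obtain ⟨cT, cX, cV⟩ := h.contDiffOn_components
  have hU := Φ.open_source
  have hXx : ∀ z ∈ Φ.source, _ := fun z hz => h.dirDeriv_x_snd_ne_zero hz
  have hXv : ∀ z ∈ Φ.source, _ := fun z hz => h.dirDeriv_v_snd_eq_zero hz
  have hTx : ∀ z ∈ Φ.source, _ := fun z hz => (h.dirDeriv_fst_eq_zero hz).1
  have hTv : ∀ z ∈ Φ.source, _ := fun z hz => (h.dirDeriv_fst_eq_zero hz).2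
  have hTt : ∀ z ∈ Φ.source, _ := fun z hz => h.dirDeriv_t_fst_ne_zero hz
  have hVv : ∀ z ∈ Φ.source, _ := fun z hz => h.dirDeriv_v_third_ne_zero hz
  have det := fun {z : ℝ × ℝ × ℝ} (hz : z ∈ Φ.source) (b μ N : ℝ) =>
    h.determining_equation hz b rfl rfl rfl (μ := μ) (N := N)
  have hreg : MapsTo base Φ.source E.region := h.base_source ▸ mapsTo_image _ _
  generalize (fun y => (Φ y).1) = T at *
  generalize (fun y => (Φ y).2.1) = X at *
  generalize (fun y => (Φ y).2.2) = V at *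
  have cF : ContDiffOn ℝ ∞ (fun y => E.f (base y)) Φ.source := by
    refine E.smooth_f.comp (ContDiff.contDiffOn ?_) hreg
    exact contDiff_fst.prodMk (contDiff_fst.comp contDiff_snd)
  have hFv : ∀ z ∈ Φ.source, dirDeriv (0, 0, 1) (fun y => E.f (base y)) z = 0 := fun z hz =>
    dirDeriv_comp_base ((E.smooth_f.contDiffAt
      (E.isOpen_region.mem_nhds (hreg hz))).differentiableAt (by simp))
  have D : ∀ {G : ℝ × ℝ × ℝ → ℝ} (u), ContDiffOn ℝ ∞ G Φ.source →
    ContDiffOn ℝ ∞ (dirDeriv u G) Φ.source := fun u h => contDiffOn_dirDeriv hU h u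
  have d : ∀ {G : ℝ × ℝ × ℝ → ℝ} {y}, y ∈ Φ.source → ContDiffOn ℝ ∞ G Φ.source →
    DifferentiableAt ℝ G y := fun hy h => differentiableAt_of_mem hU h hy
  have Z : ∀ {G : ℝ × ℝ × ℝ → ℝ} (u u'), ContDiffOn ℝ ∞ G Φ.source →
      (∀ z ∈ Φ.source, dirDeriv u G z = 0) → ∀ z ∈ Φ.source, dirDeriv u (dirDeriv u' G) z = 0 :=
    fun u u' hG h z hz => by
      rw [dirDeriv_comm hU hG hz, dirDeriv_congr hU h hz, dirDeriv_const]
  obtain ⟨μ, hμ⟩ : ∃ μ : ℝ × ℝ × ℝ → ℝ,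
    μ = fun y => dirDeriv (1, 0, 0) T y / dirDeriv (0, 1, 0) X y ^ 2 := ⟨_, rfl⟩
  obtain ⟨N, hN⟩ : ∃ N : ℝ × ℝ × ℝ → ℝ,
    N = fun y => (dirDeriv (1, 0, 0) X y + E.f (base y) *
      dirDeriv (0, 1, 0) (dirDeriv (0, 1, 0) X) y) / dirDeriv (0, 1, 0) X y := ⟨_, rfl⟩
  have cμ : ContDiffOn ℝ ∞ μ Φ.source :=
    hμ ▸ (D _ cT).div ((D _ cX).pow 2) fun z hz => pow_ne_zero 2 (hXx z hz)
  have cN : ContDiffOn ℝ ∞ N Φ.source :=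
    hN ▸ ((D _ cX).add (cF.mul (D _ (D _ cX)))).div (D _ cX) hXx
  have eμ : ∀ z ∈ Φ.source, μ z * (dirDeriv (0, 1, 0) X z * dirDeriv (0, 1, 0) X z)
      = dirDeriv (1, 0, 0) T z := fun z hz => by
    have := hXx z hz
    rw [hμ]; field_simp
  have eN : ∀ z ∈ Φ.source, N z * dirDeriv (0, 1, 0) X z = dirDeriv (1, 0, 0) X z
      + E.f (base z) * dirDeriv (0, 1, 0) (dirDeriv (0, 1, 0) X) z := fun z hz => by
    have := hXx z hz
    rw [hN]; field_simp
  have eμ' : ∀ u, ∀ z ∈ Φ.source,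
      dirDeriv u μ z * (dirDeriv (0, 1, 0) X z * dirDeriv (0, 1, 0) X z)
        + μ z * (2 * dirDeriv u (dirDeriv (0, 1, 0) X) z * dirDeriv (0, 1, 0) X z)
        = dirDeriv u (dirDeriv (1, 0, 0) T) z := fun u z hz => by
    have := dirDeriv_congr hU eμ hz u
    rw [dirDeriv_mul (d hz cμ) (d hz ((D _ cX).mul (D _ cX))),
      dirDeriv_mul (d hz (D _ cX)) (d hz (D _ cX))] at this
    rw [← this]; ring
  have hμv : ∀ z ∈ Φ.source, dirDeriv (0, 0, 1) μ z = 0 := fun z hz => by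
    have := eμ' (0, 0, 1) z hz
    rw [Z _ _ cX hXv z hz, Z _ _ cT hTv z hz] at this
    simpa [hXx z hz] using this
  have hNv : ∀ z ∈ Φ.source, dirDeriv (0, 0, 1) N z = 0 := fun z hz => by
    have := dirDeriv_congr hU eN hz (0, 0, 1)
    rw [dirDeriv_mul (d hz cN) (d hz (D _ cX)),
      dirDeriv_add (d hz (D _ cX)) (d hz (cF.mul (D _ (D _ cX)))),
      dirDeriv_mul (d hz cF) (d hz (D _ (D _ cX))), Z _ _ cX hXv z hz, Z _ _ cX hXv z hz,
      Z _ _ (D _ cX) (Z _ _ cX hXv) z hz, hFv z hz] at this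
    simpa [hXx z hz] using this
  have hdet := fun {z} (hz : z ∈ Φ.source) b =>
    det hz b (μ z) (N z) (by rw [← eμ z hz]; ring) (eN z hz)
  have hrig := fun {z} (hz : z ∈ Φ.source) =>
    dirDeriv_eq_zero_of_determining_equations (et := (1, 0, 0)) (ex := (0, 1, 0)) hU cF cμ cN cV
      hVv hFv hμv hNv
      (fun z hz => by
        linear_combination (hdet hz 1 + hdet hz (-1)) / 2 - hdet hz 0)
      (fun z hz => by
        linear_combination (hdet hz 1 - hdet hz (-1)) / 2)
      (fun z hz => by linear_combination hdet hz 0) hz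
  constructor
  · obtain ⟨k, hk⟩ := hU.exists_is_const_of_fderiv_eq_zero h.isConnected_source.isPreconnected
      (cμ.differentiableOn (by simp)) (fun z hz => by
        refine ContinuousLinearMap.ext fun u => ?_
        have := dirDeriv_eq_partials μ z u
        rw [(hrig hz).1, (hrig hz).2, hμv z hz] at this
        simpa [dirDeriv] using this)
    exact ⟨k, fun z hz => by rw [← hk z hz, ← eμ z hz]; ring⟩
  · intro z hz
    have a := eμ' (0, 1, 0) z hz
    rw [(hrig hz).2, Z _ _ cT hTx z hz] at a
    have hμ0 : μ z ≠ 0 := fun h0 => hTt z hz (by rw [← eμ z hz, h0, zero_mul])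
    have hx := hXx z hz
    simpa [hμ0, hx] using a

/-- A function with `G_x = G_v = 0` on a ball depends on `t` only there: balls for the sup metric are
products, so their slices `t = const` are convex. -/
theorem eq_of_dirDeriv_eq_zero {z : ℝ × ℝ × ℝ} {r : ℝ} {G : ℝ × ℝ × ℝ → ℝ}
    (hG : DifferentiableOn ℝ G (Metric.ball z r))
    (hx : ∀ y ∈ Metric.ball z r, dirDeriv (0, 1, 0) G y = 0)
    (hv : ∀ y ∈ Metric.ball z r, dirDeriv (0, 0, 1) G y = 0) {y : ℝ × ℝ × ℝ}
    (hy : y ∈ Metric.ball z r) : G y = G (y.1, z.2) := by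
  have hmem : ∀ q ∈ Metric.ball z.2 r, (y.1, q) ∈ Metric.ball z r := fun q hq => by
    simp only [Metric.mem_ball, Prod.dist_eq, max_lt_iff] at hq hy ⊢
    exact ⟨hy.1, hq⟩
  have hd : ∀ q ∈ Metric.ball z.2 r, HasFDerivAt (fun q => G (y.1, q))
      ((fderiv ℝ G (y.1, q)).comp (ContinuousLinearMap.inr ℝ ℝ (ℝ × ℝ))) q := fun q hq =>
    HasFDerivAt.comp q
      (hG.differentiableAt (Metric.isOpen_ball.mem_nhds (hmem q hq))).hasFDerivAt
      (hasFDerivAt_prodMk_right y.1 q)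
  have hy2 : y.2 ∈ Metric.ball z.2 r := by
    rw [Metric.mem_ball, Prod.dist_eq, max_lt_iff] at hy
    exact hy.2
  refine Metric.isOpen_ball.is_const_of_fderiv_eq_zero (𝕜 := ℝ) (f := fun q => G (y.1, q))
    (convex_ball z.2 r).isPreconnected
    (fun q hq => (hd q hq).differentiableAt.differentiableWithinAt) (fun q hq => ?_) hy2
    (Metric.mem_ball_self (Metric.pos_of_mem_ball hy))
  rw [(hd q hq).fderiv]
  have e : ∀ u : ℝ × ℝ, fderiv ℝ G (y.1, q) (0, u) = 0 := fun u => by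
    have := dirDeriv_eq_partials G (y.1, q) (0, u)
    rw [hx _ (hmem q hq), hv _ (hmem q hq)] at this
    simpa [dirDeriv] using this
  ext <;> simp [e]

theorem IsPointTransformation.exists_affine (h : IsPointTransformation E E' Φ)
    {z : ℝ × ℝ × ℝ} (hz : z ∈ Φ.source) : ∃ τ X1 X0 : ℝ → ℝ, ∃ r > 0,
      Metric.ball z r ⊆ Φ.source ∧ ∀ y ∈ Metric.ball z r,
        (Φ y).1 = τ y.1 ∧ (Φ y).2.1 = X1 y.1 * y.2.1 + X0 y.1 ∧ X1 y.1 ≠ 0 := by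
  obtain ⟨r, hr, hsub⟩ := Metric.isOpen_iff.1 Φ.open_source z hz
  obtain ⟨cT, cX, -⟩ := h.contDiffOn_components
  have hXx : ∀ z ∈ Φ.source, _ := fun z hz => h.dirDeriv_x_snd_ne_zero hz
  have hXv : ∀ z ∈ Φ.source, _ := fun z hz => h.dirDeriv_v_snd_eq_zero hz
  have hXxx := h.exists_const_and_second_deriv_eq_zero.2
  have hT : ∀ y ∈ Metric.ball z r, (Φ y).1 = (Φ (y.1, z.2)).1 := fun y hy =>
    eq_of_dirDeriv_eq_zero (G := fun y => (Φ y).1) ((cT.mono hsub).differentiableOn (by simp))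
      (fun y hy => (h.dirDeriv_fst_eq_zero (hsub hy)).1)
      (fun y hy => (h.dirDeriv_fst_eq_zero (hsub hy)).2) hy
  have hU := Φ.open_source
  generalize hX : (fun y => (Φ y).2.1) = X at *
  have cXx := contDiffOn_dirDeriv hU cX (0, 1, 0)
  have hXxv : ∀ y ∈ Φ.source, dirDeriv (0, 0, 1) (dirDeriv (0, 1, 0) X) y = 0 := fun y hy => by
    rw [dirDeriv_comm hU cX hy, dirDeriv_congr hU hXv hy, dirDeriv_const]
  have h1 : ∀ y ∈ Metric.ball z r, dirDeriv (0, 1, 0) X y = dirDeriv (0, 1, 0) X (y.1, z.2) :=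
    fun y hy => eq_of_dirDeriv_eq_zero ((cXx.mono hsub).differentiableOn (by simp))
      (fun y hy => hXxx y (hsub hy)) (fun y hy => hXxv y (hsub hy)) hy
  have cx : ContDiff ℝ ∞ fun y : ℝ × ℝ × ℝ => y.2.1 := contDiff_fst.comp contDiff_snd
  have hdx : ∀ y u, dirDeriv u (fun y : ℝ × ℝ × ℝ => y.2.1) y = u.2.1 := fun y u => by
    rw [dirDeriv, (hasFDerivAt_snd (𝕜 := ℝ) (p := y)).fst.fderiv]; rfl
  have hdG : ∀ u, ∀ y ∈ Φ.source,
      dirDeriv u (fun y => X y - dirDeriv (0, 1, 0) X y * y.2.1) y = dirDeriv u X y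
        - (dirDeriv u (dirDeriv (0, 1, 0) X) y * y.2.1 + dirDeriv (0, 1, 0) X y * u.2.1) :=
    fun u y hy => by
      rw [dirDeriv_sub (differentiableAt_of_mem hU cX hy)
        (differentiableAt_of_mem hU (cXx.mul cx.contDiffOn) hy),
        dirDeriv_mul (differentiableAt_of_mem hU cXx hy)
          (differentiableAt_of_mem hU cx.contDiffOn hy), hdx]
  -- apply the same to the intercept `X - X_x x`, using `X_xx = X_v = 0`
  have h0 := fun y hy => eq_of_dirDeriv_eq_zero (z := z) (r := r) (y := y)
      (G := fun y => X y - dirDeriv (0, 1, 0) X y * y.2.1)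
      (((cX.sub (cXx.mul cx.contDiffOn)).mono hsub).differentiableOn (by simp))
      (fun y hy => by rw [hdG _ y (hsub hy), hXxx y (hsub hy)]; simp)
      (fun y hy => by rw [hdG _ y (hsub hy), hXv y (hsub hy), hXxv y (hsub hy)]; simp) hy
  refine ⟨fun t => (Φ (t, z.2)).1, fun t => dirDeriv (0, 1, 0) X (t, z.2),
    fun t => X (t, z.2) - dirDeriv (0, 1, 0) X (t, z.2) * z.2.1, r, hr, hsub, fun y hy =>
      ⟨hT y hy, ?_, ?_⟩⟩
  · have e : (Φ y).2.1 = X y := congr_fun hX y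
    have := h0 y hy
    simp only [h1 y hy] at this
    rw [e]
    linear_combination this
  · exact (h1 y hy).symm.trans_ne (hXx y (hsub hy))

theorem IsPointTransformation.exists_ratio (h : IsPointTransformation E E' Φ) :
    ∃ c₀ : ℝ, c₀ ≠ 0 ∧ ∀ z ∈ Φ.source, E'.f (base (Φ z)) = c₀ * E.f (base z) := by
  obtain ⟨k, hk⟩ := h.exists_const_and_second_deriv_eq_zero.1
  have hk0 : k ≠ 0 := by
    obtain ⟨z, hz⟩ := h.isConnected_source.nonempty
    exact fun h0 => h.dirDeriv_t_fst_ne_zero hz (by rw [← hk z hz, h0, zero_mul])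
  refine ⟨k⁻¹, inv_ne_zero hk0, fun z hz => ?_⟩
  have hx := h.dirDeriv_x_snd_ne_zero hz
  have := h.f_image_mul hz 0 hx
  rw [← hk z hz] at this
  rw [eq_inv_mul_iff_mul_eq₀ hk0]
  apply mul_left_cancel₀ (pow_ne_zero 2 hx)
  linear_combination this

theorem IsPointTransformation.mem_P3_iff (h : IsPointTransformation E E' Φ) :
    E ∈ P3 ↔ E' ∈ P3 := by
  obtain ⟨c₀, hc, hf⟩ := h.exists_ratio
  constructor
  · rintro ⟨c, hE⟩
    refine ⟨c₀ * c, fun p hp => ?_⟩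
    rw [← h.base_target] at hp
    obtain ⟨y, hy, rfl⟩ := hp
    have hz := Φ.map_target hy
    rw [← Φ.right_inv hy, hf _ hz, hE _ (h.base_source ▸ mem_image_of_mem base hz)]
  · rintro ⟨c, hE⟩
    refine ⟨c₀⁻¹ * c, fun p hp => ?_⟩
    rw [← h.base_source] at hp
    obtain ⟨z, hz, rfl⟩ := hp
    rw [← hE _ (h.base_target ▸ mem_image_of_mem base (Φ.map_source hz)), hf _ hz]
    field_simp

/-- No smoothness is needed: for `k ≠ 0` the two sides are differentiable at the same points, and
for `k = 0` and `n > 0` both vanish. -/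
theorem iteratedDeriv_comp_affine (g : ℝ → ℝ) (k l : ℝ) (n : ℕ) (x : ℝ) :
    iteratedDeriv n (fun x => g (k * x + l)) x = k ^ n * iteratedDeriv n g (k * x + l) := by
  induction n generalizing x with
  | zero => simp
  | succ n ih =>
    rw [iteratedDeriv_succ, iteratedDeriv_succ, funext ih, deriv_const_mul_field,
      deriv_comp_mul_left k (fun y => iteratedDeriv n g (y + l)), deriv_comp_add_const,
      smul_eq_mul]
    ring

/-- Differentiating `f'(T, X¹ x + X⁰) = c₀ f` three times in `x`. -/
theorem IsPointTransformation.partialX_three_eq_zero_iff (h : IsPointTransformation E E' Φ)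
    {z : ℝ × ℝ × ℝ} (hz : z ∈ Φ.source) :
    partialX 3 E'.f (base (Φ z)) = 0 ↔ partialX 3 E.f (base z) = 0 := by
  obtain ⟨c, hc, hf⟩ := h.exists_ratio
  obtain ⟨τ, X1, X0, r, hr, hsub, hy⟩ := h.exists_affine hz
  have hz' := hy z (Metric.mem_ball_self hr)
  have hloc : (fun x => E'.f (τ z.1, X1 z.1 * x + X0 z.1)) =ᶠ[𝓝 z.2.1]
      fun x => c * E.f (z.1, x) := by
    have hcont : Tendsto (fun x : ℝ => (z.1, x, z.2.2)) (𝓝 z.2.1) (𝓝 z) := by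
      have : Continuous fun x : ℝ => (z.1, x, z.2.2) := by fun_prop
      exact this.tendsto z.2.1
    filter_upwards [hcont.eventually (Metric.ball_mem_nhds z hr)] with x hx
    have h1 := hy _ hx
    have h2 := hf _ (hsub hx)
    rw [base, h1.1, h1.2.1] at h2
    exact h2
  have key := hloc.iteratedDeriv_eq 3
  rw [iteratedDeriv_comp_affine (fun y => E'.f (τ z.1, y)), iteratedDeriv_const_mul_field] at key
  have e : base (Φ z) = (τ z.1, X1 z.1 * z.2.1 + X0 z.1) := Prod.ext hz'.1 hz'.2.1
  change X1 z.1 ^ 3 * partialX 3 E'.f (τ z.1, X1 z.1 * z.2.1 + X0 z.1)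
    = c * partialX 3 E.f (base z) at key
  rw [e, ← mul_right_inj' (pow_ne_zero 3 hz'.2.2), key, mul_zero, mul_eq_zero, or_iff_right hc]

theorem IsPointTransformation.mem_P1_iff (h : IsPointTransformation E E' Φ) :
    E ∈ P1 ↔ E' ∈ P1 := by
  constructor
  · rintro ⟨p, hp, hne⟩
    rw [← h.base_source] at hp
    obtain ⟨z, hz, rfl⟩ := hp
    exact ⟨_, h.base_target ▸ mem_image_of_mem base (Φ.map_source hz),
      mt (h.partialX_three_eq_zero_iff hz).1 hne⟩
  · rintro ⟨p, hp, hne⟩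
    rw [← h.base_target] at hp
    obtain ⟨y, hy, rfl⟩ := hp
    have hz := Φ.map_target hy
    rw [← Φ.right_inv hy] at hne
    exact ⟨_, h.base_source ▸ mem_image_of_mem base hz,
      mt (h.partialX_three_eq_zero_iff hz).2 hne⟩

theorem not_mem_P1_of_mem_P3 (h : E ∈ P3) : E ∉ P1 := by
  obtain ⟨c, hc⟩ := h
  rintro ⟨p, hp, hne⟩
  refine hne ?_
  have hcont : Tendsto (fun x : ℝ => (p.1, x)) (𝓝 p.2) (𝓝 p) := by
    have : Continuous fun x : ℝ => (p.1, x) := by fun_prop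
    exact this.tendsto p.2
  have hloc : (fun x => E.f (p.1, x)) =ᶠ[𝓝 p.2] fun _ => c := by
    filter_upwards [hcont.eventually (E.isOpen_region.mem_nhds hp)] with x hx using hc _ hx
  rw [partialX, hloc.iteratedDeriv_eq 3, iteratedDeriv_const]
  simp

theorem mem_P2_iff : E ∈ P2 ↔ E ∉ P1 ∧ E ∉ P3 := by
  simp [P1, P2, P3]

end PointTransformations
end GPBurgers

theorem proposition5 :
    (∀ (E E' : GPBurgers.Equation) (Φ : OpenPartialHomeomorph (ℝ × ℝ × ℝ) (ℝ × ℝ × ℝ)),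
      GPBurgers.IsPointTransformation E E' Φ →
        (∀ z ∈ Φ.source, ∃ τ X1 X0 : ℝ → ℝ, ∀ᶠ y in 𝓝 z,
          (Φ y).1 = τ y.1 ∧ (Φ y).2.1 = X1 y.1 * y.2.1 + X0 y.1) ∧
        (∃ c₀ : ℝ, c₀ ≠ 0 ∧ ∀ z ∈ Φ.source,
          E'.f (GPBurgers.base (Φ z)) = c₀ * E.f (GPBurgers.base z))) ∧
    (∀ i j : Fin 3, i ≠ j →
      ∀ E ∈ ![GPBurgers.P1, GPBurgers.P2, GPBurgers.P3] i,
      ∀ E' ∈ ![GPBurgers.P1, GPBurgers.P2, GPBurgers.P3] j,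
        ¬ ∃ Φ : OpenPartialHomeomorph (ℝ × ℝ × ℝ) (ℝ × ℝ × ℝ),
          GPBurgers.IsPointTransformation E E' Φ) := by
  refine ⟨fun E E' Φ h => ⟨fun z hz => ?_, h.exists_ratio⟩, ?_⟩
  · obtain ⟨τ, X1, X0, r, hr, -, hy⟩ := h.exists_affine hz
    exact ⟨τ, X1, X0, by
      filter_upwards [Metric.ball_mem_nhds z hr] with y hyr using
        ⟨(hy y hyr).1, (hy y hyr).2.1⟩⟩
  · rintro i j hij E hE E' hE' ⟨Φ, h⟩
    have h1 := h.mem_P1_iff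
    have h3 := h.mem_P3_iff
    have e1 := GPBurgers.not_mem_P1_of_mem_P3 (E := E)
    have e1' := GPBurgers.not_mem_P1_of_mem_P3 (E := E')
    fin_cases i <;> fin_cases j <;> simp [GPBurgers.mem_P2_iff] at hij hE hE' <;> tauto
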